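/- Let $K$ be a field, $T=K[x_1,x_2,\ldots]$ and $T_N=K[x_1,\ldots,x_N]\subset T$ for $N\ge 0$. For a nonzero monomial ideal $J$ let $G(J)$ be its set of minimal monomial generators and $\deg(J)=\max\{\deg u : u\in G(J)\}$. The squarefree operator $\sigma$ sends a monomial $u=x_{i_1}x_{i_2}\cdots x_{i_e}$ with $i_1\le i_2\le\cdots\le i_e$ to $\sigma(u)=x_{i_1}x_{i_2+1}\cdots x_{i_e+e-1}$; $J^{\sigma}$ is the ideal generated by $\sigma(u)$, $u\in G(J)$, and $J^{\sigma^0}=J$, $J^{\sigma^k}=(J^{\sigma^{k-1}})^{\sigma}$ for $k\ge1$. Let $1\le n\le t$, let $0\ne I\subseteq T_n$ be a monomial ideal and $d=\deg(I)$. Regard $I^{\sigma^n}$ as an ideal of $T_{nd}$ and $I^{\sigma^t}$ as an ideal of $T_{td}$. Then: 1. There is an isomorphism of $K$-algebras $$T_{nd}/I^{\sigma^n}\;\cong\; T_{td}\big/\big(I^{\sigma^t},\ x_{bt+r} : 0\le b<d,\ n<r\le t\big),\qquad x_j\mapsto x_{j+\lfloor (j-1)/n\rfloor (t-n)}\quad(1\le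 j\le nd).$$ 2. $\operatorname{depth}(T_{td}/I^{\sigma^t})=\operatorname{depth}(T_{nd}/I^{\sigma^n})+(t-n)d$. 3. $\operatorname{sdepth}(T_{td}/I^{\sigma^t})=\operatorname{sdepth}(T_{nd}/I^{\sigma^n})+(t-n)d$. 4. $\operatorname{sdepth}(I^{\sigma^t})=\operatorname{sdepth}(I^{\sigma^n})+(t-n)d$. The same four statements hold if, for every $k$, $I^{\sigma^k}$ is replaced by the ideal generated by the monomials $\sigma^k(u)$, $u\in G(I)$. Here $\operatorname{depth}(M)$ is the supremum of the lengths of $M$-regular sequences contained in the ideal generated by the variables. For a multigraded $T_N$-module $M$, $\operatorname{sdepth}(M)$ is the maximum of $\min_i|Z_i|$ over all Stanley decompositions $M=\bigoplus_{i=1}^r u_iK[Z_i]$ (a direct sum of $K$-vector spaces, with $u_i\in M$ homogeneous, $Z_i\subseteq\{x_1,\ldots,x_N\}$, and $u_iK[Z_i]$ a free $K[Z_i]$-module). For the zero module, which occurs only if $I=T_n$ and $d=0$, depth is $0$ and sdepth is $\infty$ by convention. -/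

import Mathlib

/-!
Conventions: `T = K[x_1, x_2, …]` is `MvPolynomial ℕ K` and `T_N = K[x_1, …, x_N]` is
`MvPolynomial (Fin N) K`; the variable `x_{i+1}` is `X i` (indices start at `0`).
A monomial is represented by its exponent vector. The inclusion `T_N ⊆ T` is `rename Fin.val`.
-/

namespace SqOp

noncomputable section

open MvPolynomial

/-- `I` is a monomial ideal: it is generated by monomials. -/
def IsMonomialIdeal {K τ : Type*} [Field K] (I : Ideal (MvPolynomial τ K)) : Prop :=
  ∃ S : Set (τ →₀ ℕ), I = Ideal.span ((fun a => monomial a (1 : K)) '' S)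

/-- `G(I)`: the (exponent vectors of the) minimal monomial generators of a monomial ideal, that is,
the monomials of `I` that are minimal with respect to divisibility. -/
def minGens {K τ : Type*} [Field K] (I : Ideal (MvPolynomial τ K)) : Set (τ →₀ ℕ) :=
  {a | Minimal (fun b => monomial b (1 : K) ∈ I) a}

/-- `deg(I) = max {deg u : u ∈ G(I)}`. -/
def idealDegree {K τ : Type*} [Field K] (I : Ideal (MvPolynomial τ K)) : ℕ :=
  sSup (Finsupp.degree '' minGens I)

/-- The squarefree operator on monomials of `T`: with `i_1 ≤ i_2 ≤ ⋯ ≤ i_d`,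
`σ(x_{i_1} x_{i_2} ⋯ x_{i_d}) = x_{i_1} x_{i_2 + 1} ⋯ x_{i_d + d - 1}`. -/
def sigma (u : ℕ →₀ ℕ) : ℕ →₀ ℕ :=
  Multiset.toFinsupp
    (((u.toMultiset.sort (· ≤ ·)).mapIdx fun l i => i + l : List ℕ) : Multiset ℕ)

/-- `J^σ`: the ideal generated by `σ(u)`, `u ∈ G(J)`. -/
def sqIdeal {K : Type*} [Field K] (J : Ideal (MvPolynomial ℕ K)) : Ideal (MvPolynomial ℕ K) :=
  Ideal.span ((fun u => monomial (sigma u) (1 : K)) '' minGens J)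

/-- `I^{σ^t}` for an ideal `I` of `T_n`, by the recursion `I^{σ^t} = (I^{σ^{t-1}})^σ`,
as an ideal of `T`. -/
def iterSqIdeal {K : Type*} [Field K] {n : ℕ} (I : Ideal (MvPolynomial (Fin n) K)) (t : ℕ) :
    Ideal (MvPolynomial ℕ K) :=
  sqIdeal^[t] (I.map (rename (Fin.val : Fin n → ℕ) : MvPolynomial (Fin n) K →ₐ[K] _))

/-- The ideal of `T` generated by the monomials `σ^t(u)`, `u ∈ G(I)`. -/
def genSqIdeal {K : Type*} [Field K] {n : ℕ} (I : Ideal (MvPolynomial (Fin n) K)) (t : ℕ) :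
    Ideal (MvPolynomial ℕ K) :=
  Ideal.span ((fun u : Fin n →₀ ℕ => monomial (sigma^[t] (u.mapDomain Fin.val)) (1 : K)) ''
    minGens I)

/-- An ideal `J` of `T` considered as an ideal of `T_N`, namely `J ∩ T_N`. When `J` is generated by
monomials of `T_N`, this is the ideal of `T_N` generated by the same monomials. -/
def inT {K : Type*} [Field K] (N : ℕ) (J : Ideal (MvPolynomial ℕ K)) :
    Ideal (MvPolynomial (Fin N) K) :=
  J.comap (rename (Fin.val : Fin N → ℕ) : MvPolynomial (Fin N) K →ₐ[K] MvPolynomial ℕ K)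

/-- The depth of a module over `K[x_τ]`: the supremum of the lengths of the `M`-regular sequences
contained in the graded maximal ideal generated by the variables. -/
def depth (K τ M : Type*) [Field K] [AddCommGroup M] [Module (MvPolynomial τ K) M] : ℕ∞ :=
  sSup {k : ℕ∞ | ∃ rs : List (MvPolynomial τ K),
    (rs.length : ℕ∞) = k ∧
    (∀ r ∈ rs, r ∈ Ideal.span (Set.range (X : τ → MvPolynomial τ K))) ∧
    RingTheory.Sequence.IsRegular M rs}

/-- The `K`-subspace `u K[Z]` of `M`. -/
def stanleySpace {K τ M : Type*} [Field K] [AddCommGroup M] [Module K M]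
    [Module (MvPolynomial τ K) M] [IsScalarTower K (MvPolynomial τ K) M]
    (u : M) (Z : Finset τ) : Submodule K M :=
  (Subalgebra.toSubmodule (supported K (Z : Set τ))).map
    ((LinearMap.toSpanSingleton (MvPolynomial τ K) M u).restrictScalars K)

/-- A Stanley decomposition of a multigraded module `M` with graded components `𝒜 a`: finitely many
homogeneous elements `u i` and sets of variables `Z i` such that each `u i K[Z i]` is a free
`K[Z i]`-module and `M = ⨁ u i K[Z i]` as a `K`-vector space. -/
structure StanleyDecomposition {K τ M : Type*} [Field K] [AddCommGroup M] [Module K M]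
    [Module (MvPolynomial τ K) M] [IsScalarTower K (MvPolynomial τ K) M]
    (𝒜 : (τ →₀ ℕ) → Submodule K M) where
  /-- the number of summands -/
  r : ℕ
  /-- the homogeneous generators -/
  u : Fin r → M
  /-- the sets of variables -/
  Z : Fin r → Finset τ
  homogeneous : ∀ i, ∃ a, u i ∈ 𝒜 a
  free : ∀ i, ∀ p ∈ supported K (Z i : Set τ), p • u i = 0 → p = 0
  isInternal : DirectSum.IsInternal fun i => stanleySpace (K := K) (u i) (Z i)

/-- The Stanley depth: the maximum over all Stanley decompositions of `min_i |Z i|`. -/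
def sdepth {K τ M : Type*} [Field K] [AddCommGroup M] [Module K M]
    [Module (MvPolynomial τ K) M] [IsScalarTower K (MvPolynomial τ K) M]
    (𝒜 : (τ →₀ ℕ) → Submodule K M) : ℕ∞ :=
  ⨆ D : StanleyDecomposition 𝒜, ⨅ i, ((D.Z i).card : ℕ∞)

/-- The multigrading of `K[x_τ] / I`: the component of degree `a` is spanned by the class
of `x^a`. -/
def quotGrading {K τ : Type*} [Field K] (I : Ideal (MvPolynomial τ K)) (a : τ →₀ ℕ) :
    Submodule K (MvPolynomial τ K ⧸ I) :=
  Submodule.span K {Ideal.Quotient.mk I (monomial a 1)}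

/-- The multigrading of a monomial ideal `I`: the component of degree `a` is `I ∩ K x^a`. -/
def idealGrading {K τ : Type*} [Field K] (I : Ideal (MvPolynomial τ K)) (a : τ →₀ ℕ) :
    Submodule K I :=
  (Submodule.span K {(monomial a (1 : K) : MvPolynomial τ K)}).comap
    (I.subtype.restrictScalars K)

/-- The ideal of `T_{td}` generated by the `(t-n)d` added variables
`x_{bt+n+1}, …, x_{(b+1)t}`, `0 ≤ b < d`. -/
def extraVars (K : Type*) [Field K] (n t d : ℕ) : Ideal (MvPolynomial (Fin (t * d)) K) :=
  Ideal.span {p | ∃ j : Fin (t * d), n ≤ (j : ℕ) % t ∧ p = X j}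

end

end SqOp

/-! Iterating gives `σ^k(x_{i_1} ⋯ x_{i_e}) = x_{i_1} x_{i_2+k} ⋯ x_{i_e+(e-1)k}` (`sigma_iterate`).
If all indices are at most `n ≤ k`, the factors lie in separate blocks of length `k`, each using
only the first `n` places. So the injection of variables `bn + r ↦ bt + r` carries `σ^n(u)` to
`σ^t(u)`. Reduction of indices modulo `k` recovers `u`, so divisibility between the `σ^k(u)` implies
divisibility between the `u`: from step `n` on no generator is lost (`exists_iterSqIdeal_eq_of_le`).
Hence `I^{σ^t}` is the extension of `I^{σ^n}` along an injection of variables that misses `(t-n)d`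
of them (`exists_generators`).

The rest concerns such extensions. Killing the missed variables gives statement 1. They form a
regular sequence on the quotient, and over a noetherian ring each regular element lowers by exactly
one the possible lengths of regular sequences in the ideal (`HasWeaklyRegularSeq.quotSMulTop`,
proved by exchange); this gives the depth. Stanley decompositions amount to partitions of a set of
exponent vectors into blocks (`IsMonomialBasis.sdepth_eq`), to which free variables can be added or
from which they can be removed (`setSdepth_comapDomain`). -/

/-! ### Regular sequences in an ideal and their lengths -/

open RingTheory.Sequence Pointwise in
/-- There is a weakly `M`-regular sequence of length `k` contained in the ideal `I`. -/
def HasWeaklyRegularSeq {R : Type*} [CommRing R] (I : Ideal R) (M : Type*) [AddCommGroup M]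
    [Module R M] (k : ℕ) : Prop :=
  ∃ rs : List R, rs.length = k ∧ (∀ r ∈ rs, r ∈ I) ∧ IsWeaklyRegular M rs

namespace HasWeaklyRegularSeq

open RingTheory.Sequence Pointwise

section

variable {R : Type*} [CommRing R] {I : Ideal R} {M N : Type*} [AddCommGroup M] [Module R M]
  [AddCommGroup N] [Module R N]

theorem zero : HasWeaklyRegularSeq I M 0 := ⟨[], rfl, by simp, .nil R M⟩

theorem succ_iff {k : ℕ} : HasWeaklyRegularSeq I M (k + 1) ↔
    ∃ x ∈ I, IsSMulRegular M x ∧ HasWeaklyRegularSeq I (QuotSMulTop x M) k := by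
  constructor
  · rintro ⟨rs, hl, hI, hreg⟩
    cases rs with
    | nil => simp at hl
    | cons x rs =>
      rw [isWeaklyRegular_cons_iff] at hreg
      exact ⟨x, hI x (by simp), hreg.1, rs, by simpa using hl, fun r hr => hI r (by simp [hr]),
        hreg.2⟩
  · rintro ⟨x, hx, hreg, rs, hl, hI, h⟩
    refine ⟨x :: rs, by simp [hl], ?_, .cons hreg h⟩
    intro r hr
    rcases List.mem_cons.1 hr with rfl | hr
    exacts [hx, hI r hr]

theorem congr (e : M ≃ₗ[R] N) {k : ℕ} :
    HasWeaklyRegularSeq I M k ↔ HasWeaklyRegularSeq I N k := by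
  simp only [HasWeaklyRegularSeq, e.isWeaklyRegular_congr]

end

section

variable {R : Type*} [CommRing R] {I : Ideal R} {M : Type*} [AddCommGroup M] [Module R M]

/-- If no nonzero element of a finite module over a noetherian ring is annihilated by `I`, then `I`
contains a regular element. -/
theorem exists_isSMulRegular [IsNoetherianRing R] [Module.Finite R M]
    (h : ∀ m : M, (∀ a ∈ I, a • m = 0) → m = 0) : ∃ x ∈ I, IsSMulRegular M x := by
  by_contra! hc
  -- Prime avoidance: an ideal of zero divisors lies in a single associated prime, the annihilator
  -- of some `m`.
  have hsub : (I : Set R) ⊆ ⋃ p ∈ associatedPrimes R M, (p : Set R) := by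
    rw [biUnion_associatedPrimes_eq_compl_regular]
    exact fun x hx => hc x hx
  obtain ⟨P, hP, hle⟩ := (I.subset_union_prime_finite (associatedPrimes.finite R M) (f := id) 0 0
    fun _ h _ _ => h.1).1 hsub
  rw [AssociatedPrimes.mem_iff, isAssociatedPrime_iff] at hP
  obtain ⟨hprime, m, hm⟩ := hP
  have hm0 : m = 0 := h m fun a ha => by
    have : a ∈ P := hle ha
    rw [hm] at this
    simpa using this
  exact hprime.ne_top (by rw [hm, hm0]; ext; simp)

theorem isSMulRegular_quotSMulTop_iff {x y : R} :
    IsSMulRegular (QuotSMulTop x M) y ↔ ∀ m : M, (∃ n, y • m = x • n) → ∃ n, m = x • n := by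
  rw [isSMulRegular_quotient_iff_mem_of_smul_mem]
  simp [Submodule.mem_smul_pointwise_iff_exists, eq_comm]

/-- If `x m = z n`, then regularity of `z` modulo `x` gives `n = x n'`, and cancelling `x` leaves `m
= z n'`. -/
theorem isSMulRegular_quotSMulTop_swap {x z : R} (hx : IsSMulRegular M x)
    (h : IsSMulRegular (QuotSMulTop x M) z) :
    IsSMulRegular (QuotSMulTop z M) x := by
  rw [isSMulRegular_quotSMulTop_iff] at h ⊢
  rintro m ⟨n, hn⟩
  obtain ⟨n', rfl⟩ := h n ⟨m, hn.symm⟩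
  exact ⟨n', hx (by simpa [smul_comm z x] using hn)⟩

/-- For two `M`-regular elements `x, y` of `I`, if `M / yM` has no nonzero element annihilated by
`I`, then neither has `M / xM`. -/
theorem eq_zero_of_forall_smul_eq_zero {x y : R} (hyI : y ∈ I)
    (hx : IsSMulRegular M x) (hy : IsSMulRegular M y)
    (h : ∀ m : QuotSMulTop y M, (∀ a ∈ I, a • m = 0) → m = 0)
    (m : QuotSMulTop x M) (hm : ∀ a ∈ I, a • m = 0) : m = 0 := by
  obtain ⟨m, rfl⟩ := Submodule.Quotient.mk_surjective _ m
  simp only [← Submodule.Quotient.mk_smul, Submodule.Quotient.mk_eq_zero,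
    Submodule.mem_smul_pointwise_iff_exists, Submodule.mem_top, true_and] at hm ⊢
  obtain ⟨m', hm'⟩ := hm y hyI
  -- Here `x m' = y m`. Cancelling `x` shows `a m' ∈ yM` for every `a ∈ I`, so the hypothesis on `M
  -- / yM` applies to the class of `m'`.
  have key : (Submodule.Quotient.mk m' : QuotSMulTop y M) = 0 := by
    refine h _ fun a ha => ?_
    rw [← Submodule.Quotient.mk_smul, Submodule.Quotient.mk_eq_zero,
      Submodule.mem_smul_pointwise_iff_exists]
    obtain ⟨n, hn⟩ := hm a ha
    refine ⟨n, trivial, hx ?_⟩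
    change x • y • n = x • a • m'
    rw [smul_comm x y, hn, smul_comm x a, hm', smul_comm]
  rw [Submodule.Quotient.mk_eq_zero, Submodule.mem_smul_pointwise_iff_exists] at key
  obtain ⟨n, -, rfl⟩ := key
  exact ⟨n, hy (by simpa [smul_comm x y] using hm')⟩

/-- `(M / xM) / y(M / xM)` and `(M / yM) / x(M / yM)` are isomorphic. -/
noncomputable def quotSMulTopSwap (x y : R) :
    QuotSMulTop y (QuotSMulTop x M) ≃ₗ[R] QuotSMulTop x (QuotSMulTop y M) :=
  have h (N : Type _) [AddCommGroup N] [Module R N] :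
      (y • ⊤ : Submodule R N) = Ideal.ofList [y] • ⊤ := by
    rw [Ideal.ofList_singleton, Submodule.ideal_span_singleton_smul]
  Submodule.quotEquivOfEq _ _ (h _) ≪≫ₗ
    (Submodule.quotOfListConsSMulTopEquivQuotSMulTopInner M x [y]).symm ≪≫ₗ
    Submodule.quotOfListConsSMulTopEquivQuotSMulTopOuter M x [y] ≪≫ₗ
    QuotSMulTop.congr x (Submodule.quotEquivOfEq _ _ (h M).symm)

end

/-- Exchange argument. Let `y` start the given sequence and choose `z ∈ I` regular on `M`, `M / xM`
and `M / yM` at once. The induction hypothesis removes `z` from `M / yM`; swapping `y` and `z` gives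
a sequence of length `k + 1` on `M / zM` that starts with `y`. Removing `x` from `M / zM` and
swapping again gives one on `M / xM` that starts with `z`. -/
theorem quotSMulTop {R : Type*} [CommRing R] [IsNoetherianRing R] {I : Ideal R} {k : ℕ}
    {M : Type*} [AddCommGroup M] [Module R M] [Module.Finite R M] {x : R} (hxI : x ∈ I)
    (hx : IsSMulRegular M x) (h : HasWeaklyRegularSeq I M (k + 1)) :
    HasWeaklyRegularSeq I (QuotSMulTop x M) k := by
  induction k generalizing M x with
  | zero => exact zero
  | succ k ih =>
    obtain ⟨y, hyI, hy, hM⟩ := succ_iff.1 h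
    obtain ⟨w, hwI, hw, -⟩ := succ_iff.1 hM
    have hsoc := eq_zero_of_forall_smul_eq_zero hyI hx hy
      fun m hm => hw.right_eq_zero_of_smul (hm w hwI)
    -- One application of prime avoidance to the direct sum handles all three modules.
    obtain ⟨z, hzI, hz⟩ : ∃ z ∈ I, IsSMulRegular (M × QuotSMulTop x M × QuotSMulTop y M) z := by
      refine exists_isSMulRegular fun ⟨m₁, m₂, m₃⟩ hm => ?_
      simp only [Prod.smul_mk, Prod.mk_eq_zero] at hm ⊢
      exact ⟨hx.right_eq_zero_of_smul (hm x hxI).1, hsoc _ fun a ha => (hm a ha).2.1,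
        hw.right_eq_zero_of_smul (hm w hwI).2.2⟩
    have hz₁ : IsSMulRegular M z := hz.of_injective (LinearMap.inl R _ _) LinearMap.inl_injective
    have hz₂₃ : IsSMulRegular (QuotSMulTop x M × QuotSMulTop y M) z :=
      hz.of_injective (LinearMap.inr R _ _) LinearMap.inr_injective
    have hz₂ : IsSMulRegular (QuotSMulTop x M) z :=
      hz₂₃.of_injective (LinearMap.inl R _ _) LinearMap.inl_injective
    have hz₃ : IsSMulRegular (QuotSMulTop y M) z :=
      hz₂₃.of_injective (LinearMap.inr R _ _) LinearMap.inr_injective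
    have h₁ : HasWeaklyRegularSeq I (QuotSMulTop z M) (k + 1) :=
      succ_iff.2 ⟨y, hyI, isSMulRegular_quotSMulTop_swap hy hz₃,
        (congr (quotSMulTopSwap y z)).1 (ih hzI hz₃ hM)⟩
    exact succ_iff.2 ⟨z, hzI, hz₂, (congr (quotSMulTopSwap z x)).1
      (ih hxI (isSMulRegular_quotSMulTop_swap hx hz₂) h₁)⟩

theorem succ_iff_quotSMulTop {R : Type*} [CommRing R] [IsNoetherianRing R] {I : Ideal R} {k : ℕ}
    {M : Type*} [AddCommGroup M] [Module R M] [Module.Finite R M] {x : R} (hxI : x ∈ I)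
    (hx : IsSMulRegular M x) :
    HasWeaklyRegularSeq I M (k + 1) ↔ HasWeaklyRegularSeq I (QuotSMulTop x M) k :=
  ⟨quotSMulTop hxI hx, fun h => succ_iff.2 ⟨x, hxI, hx, h⟩⟩

end HasWeaklyRegularSeq

open MvPolynomial RingTheory.Sequence

/-! ### Monomial ideals, added variables and depth -/

namespace SqOp

/-- The monomial ideal generated by the monomials with exponent vectors in `S`. -/
noncomputable abbrev monomialSpan (K : Type*) {τ : Type*} [Field K] (S : Set (τ →₀ ℕ)) :
    Ideal (MvPolynomial τ K) :=
  Ideal.span ((fun a => monomial a (1 : K)) '' S)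

section

variable {K σ τ : Type*} [Field K]

theorem monomial_mem_monomialSpan {S : Set (τ →₀ ℕ)} {b : τ →₀ ℕ} :
    monomial b (1 : K) ∈ monomialSpan K S ↔ ∃ a ∈ S, a ≤ b := by
  classical
  rw [mem_ideal_span_monomial_image]
  simp [support_monomial]

theorem mem_monomialSpan_iff {S : Set (τ →₀ ℕ)} {p : MvPolynomial τ K} :
    p ∈ monomialSpan K S ↔ ∀ b ∈ p.support, monomial b (1 : K) ∈ monomialSpan K S := by
  simp only [monomial_mem_monomialSpan]
  exact mem_ideal_span_monomial_image

theorem monomialSpan_union_single {S : Set (τ →₀ ℕ)} {E : Set τ} :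
    monomialSpan K (S ∪ (fun y => Finsupp.single y 1) '' E) =
      monomialSpan K S ⊔ Ideal.span (X '' E) := by
  rw [monomialSpan, Set.image_union, Ideal.span_union, Set.image_image]
  rfl

/-- A generator free of `y` that divides `x_y x^b` already divides `x^b`. -/
theorem isSMulRegular_X {S : Set (τ →₀ ℕ)} {y : τ} (h : ∀ a ∈ S, a y = 0) :
    IsSMulRegular (MvPolynomial τ K ⧸ monomialSpan K S) (X y : MvPolynomial τ K) := by
  rw [isSMulRegular_quotient_iff_mem_of_smul_mem]
  intro p hp
  rw [mem_ideal_span_monomial_image] at hp ⊢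
  intro b hb
  obtain ⟨a, ha, hle⟩ := hp (Finsupp.single y 1 + b) (by
    rw [mem_support_iff] at hb ⊢
    rwa [smul_eq_mul, coeff_X_mul])
  refine ⟨a, ha, fun i => ?_⟩
  have := hle i
  by_cases hi : i = y
  · subst hi; simp [h a ha]
  · simpa [Finsupp.single_apply, Ne.symm hi] using this

/-- `(R / L) / x(R / L)` is `R / (L, x)`. -/
noncomputable def quotSMulTopQuotientEquiv {R : Type*} [CommRing R] (L : Ideal R) (x : R) :
    QuotSMulTop x (R ⧸ L) ≃ₗ[R] R ⧸ (L ⊔ Ideal.span {x}) :=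
  Submodule.quotEquivOfEq _ _ (by
    apply le_antisymm
    · intro m hm
      obtain ⟨n, -, rfl⟩ := (Submodule.mem_smul_pointwise_iff_exists ..).1 hm
      obtain ⟨n, rfl⟩ := Submodule.Quotient.mk_surjective _ n
      exact ⟨x • n, by simpa using Ideal.mul_mem_right _ _ (Ideal.mem_span_singleton_self x), rfl⟩
    · rintro _ ⟨m, hm, rfl⟩
      obtain ⟨n, rfl⟩ := Ideal.mem_span_singleton'.1 hm
      exact (Submodule.mem_smul_pointwise_iff_exists ..).2
        ⟨Submodule.Quotient.mk n, trivial, by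
          rw [← Submodule.Quotient.mk_smul, smul_eq_mul, mul_comm]; rfl⟩) ≪≫ₗ
    Submodule.quotientQuotientEquivQuotientSup L (Ideal.span {x})

variable (K τ) in
/-- The graded maximal ideal. -/
noncomputable abbrev irrelevant : Ideal (MvPolynomial τ K) :=
  Ideal.span (Set.range (X : τ → MvPolynomial τ K))

theorem X_mem_irrelevant (i : τ) : (X i : MvPolynomial τ K) ∈ irrelevant K τ :=
  Ideal.subset_span ⟨i, rfl⟩

/-- The variables of `E` are removed one at a time. Those already removed count as monomial
generators, and they do not involve the next variable, which therefore stays regular. -/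
theorem hasWeaklyRegularSeq_union_single [Finite τ] {S : Set (τ →₀ ℕ)} (E : Finset τ)
    (h : ∀ a ∈ S, ∀ y ∈ E, a y = 0) {k : ℕ} :
    HasWeaklyRegularSeq (irrelevant K τ) (MvPolynomial τ K ⧸ monomialSpan K S) (k + E.card) ↔
      HasWeaklyRegularSeq (irrelevant K τ)
        (MvPolynomial τ K ⧸ (monomialSpan K S ⊔ Ideal.span (X '' (E : Set τ)))) k := by
  classical
  induction E using Finset.induction_on generalizing k with
  | empty =>
    exact HasWeaklyRegularSeq.congr (Submodule.quotEquivOfEq _ _ (by simp))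
  | insert y E hy ih =>
    rw [Finset.card_insert_of_notMem hy, show k + (E.card + 1) = k + 1 + E.card by ring,
      ih fun a ha y hy => h a ha y (by simp [hy]), ← monomialSpan_union_single,
      HasWeaklyRegularSeq.succ_iff_quotSMulTop (x := X y) (X_mem_irrelevant y)
        (isSMulRegular_X ?_),
      HasWeaklyRegularSeq.congr (quotSMulTopQuotientEquiv _ _)]
    · refine HasWeaklyRegularSeq.congr (Submodule.quotEquivOfEq _ _ ?_)
      rw [monomialSpan_union_single, Finset.coe_insert, Set.image_insert_eq, Ideal.span_insert]
      exact (sup_assoc _ _ _).trans (congrArg _ (sup_comm _ _))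
    · rintro a (ha | ⟨z, hz, rfl⟩)
      · exact h a ha y (by simp)
      · have : z ≠ y := by rintro rfl; exact hy hz
        simp [this]

variable (K) in
/-- The retraction of `rename f` sending the variables outside of the range of `f` to zero. -/
noncomputable def retraction (f : σ → τ) : MvPolynomial τ K →ₐ[K] MvPolynomial σ K :=
  aeval (Function.extend f X 0)

theorem retraction_rename {f : σ → τ} (hf : Function.Injective f) (p : MvPolynomial σ K) :
    retraction K f (rename f p) = p := by
  rw [retraction, aeval_rename, Function.extend_comp hf, aeval_X_left_apply]

theorem rename_retraction_sub_mem (f : σ → τ) (hf : Function.Injective f) (p : MvPolynomial τ K) :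
    rename f (retraction K f p) - p ∈ Ideal.span ((X : τ → MvPolynomial τ K) '' (Set.range f)ᶜ) := by
  rw [← Ideal.Quotient.eq]
  suffices ((Ideal.Quotient.mkₐ K (Ideal.span ((X : τ → MvPolynomial τ K) '' (Set.range f)ᶜ))).comp
      (rename f)).comp (retraction K f) = Ideal.Quotient.mkₐ K _ from DFunLike.congr_fun this p
  apply algHom_ext
  intro i
  by_cases hi : ∃ j, f j = i
  · obtain ⟨j, rfl⟩ := hi
    simp [retraction, hf.extend_apply]
  · have : (0 : MvPolynomial τ K ⧸ Ideal.span ((X : τ → MvPolynomial τ K) '' (Set.range f)ᶜ)) =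
        Ideal.Quotient.mk _ (X i) :=
      (Ideal.Quotient.eq_zero_iff_mem.2 (Ideal.subset_span (Set.mem_image_of_mem X hi))).symm
    simpa [retraction, Function.extend_apply' _ _ _ hi] using this

theorem rename_monomialSpan_le (f : σ → τ) (S : Set (σ →₀ ℕ)) :
    monomialSpan K S ≤ (monomialSpan K (Finsupp.mapDomain f '' S)).comap
      (rename f : MvPolynomial σ K →ₐ[K] MvPolynomial τ K) := by
  rw [Ideal.span_le]
  rintro _ ⟨a, ha, rfl⟩
  rw [SetLike.mem_coe, Ideal.mem_comap, rename_monomial]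
  exact Ideal.subset_span ⟨_, ⟨a, ha, rfl⟩, rfl⟩

theorem monomialSpan_le_comap_retraction (f : σ → τ) (hf : Function.Injective f)
    (S : Set (σ →₀ ℕ)) :
    monomialSpan K (Finsupp.mapDomain f '' S) ≤ (monomialSpan K S).comap (retraction K f) := by
  rw [Ideal.span_le]
  rintro _ ⟨_, ⟨a, ha, rfl⟩, rfl⟩
  simp only [SetLike.mem_coe, Ideal.mem_comap]
  rw [← rename_monomial, retraction_rename hf]
  exact Ideal.subset_span ⟨a, ha, rfl⟩

theorem comap_rename_monomialSpan (f : σ → τ) (hf : Function.Injective f) (S : Set (σ →₀ ℕ)) :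
    (monomialSpan K (Finsupp.mapDomain f '' S)).comap
      (rename f : MvPolynomial σ K →ₐ[K] MvPolynomial τ K) = monomialSpan K S := by
  refine le_antisymm (fun p hp => ?_) (rename_monomialSpan_le f S)
  rw [← retraction_rename hf p]
  exact monomialSpan_le_comap_retraction f hf S hp

/-- Adding variables to a monomial ideal and factoring them out again does not change the
quotient algebra. -/
noncomputable def quotientEquivOfExtension (f : σ → τ) (hf : Function.Injective f)
    (S : Set (σ →₀ ℕ)) :
    (MvPolynomial σ K ⧸ monomialSpan K S) ≃ₐ[K] (MvPolynomial τ K ⧸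
      (monomialSpan K (Finsupp.mapDomain f '' S) ⊔ Ideal.span (X '' (Set.range f)ᶜ))) :=
  AlgEquiv.ofAlgHom
    (Ideal.quotientMapₐ _ (rename f) ((rename_monomialSpan_le f S).trans
      (Ideal.comap_mono le_sup_left)))
    (Ideal.quotientMapₐ _ (retraction K f) (by
      rw [sup_le_iff, Ideal.span_le (s := X '' (Set.range f)ᶜ)]
      constructor
      · exact monomialSpan_le_comap_retraction f hf S
      · rintro _ ⟨i, hi, rfl⟩
        have hi' : ¬ ∃ j, f j = i := hi
        simp [retraction, Function.extend_apply' _ _ _ hi']))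
    (by
      apply Ideal.Quotient.algHom_ext
      ext i
      change Ideal.Quotient.mk _ (rename f (retraction K f (X i))) = Ideal.Quotient.mk _ (X i)
      rw [Ideal.Quotient.eq]
      exact Ideal.mem_sup_right (rename_retraction_sub_mem f hf _))
    (by
      apply Ideal.Quotient.algHom_ext
      ext i
      change Ideal.Quotient.mk _ (retraction K f (rename f (X i))) = Ideal.Quotient.mk _ (X i)
      rw [retraction_rename hf])

theorem quotientEquivOfExtension_mk (f : σ → τ) (hf : Function.Injective f) (S : Set (σ →₀ ℕ))
    (p : MvPolynomial σ K) :
    quotientEquivOfExtension f hf S (Ideal.Quotient.mk _ p) =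
      Ideal.Quotient.mk _ (rename f p) := rfl

theorem rename_mem_irrelevant (f : σ → τ) {p : MvPolynomial σ K} (hp : p ∈ irrelevant K σ) :
    rename f p ∈ irrelevant K τ := by
  have : irrelevant K σ ≤ (irrelevant K τ).comap
      (rename f : MvPolynomial σ K →ₐ[K] MvPolynomial τ K) := by
    rw [irrelevant, Ideal.span_le]
    rintro _ ⟨i, rfl⟩
    simpa using X_mem_irrelevant (f i)
  exact this hp

theorem retraction_mem_irrelevant (f : σ → τ) (hf : Function.Injective f) {p : MvPolynomial τ K}
    (hp : p ∈ irrelevant K τ) : retraction K f p ∈ irrelevant K σ := by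
  have : irrelevant K τ ≤ (irrelevant K σ).comap (retraction K f) := by
    rw [irrelevant, Ideal.span_le]
    rintro _ ⟨i, rfl⟩
    by_cases hi : ∃ j, f j = i
    · obtain ⟨j, rfl⟩ := hi
      simpa [retraction, hf.extend_apply] using X_mem_irrelevant j
    · simp [retraction, Function.extend_apply' _ _ _ hi]
  exact this hp

/-- The isomorphism of quotients is semilinear along `rename f` and, in the other direction, along
the retraction, since their composite is the identity modulo the killed variables. Thus sequences
can be carried both ways. -/
theorem hasWeaklyRegularSeq_extension_iff (f : σ → τ) (hf : Function.Injective f)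
    (S : Set (σ →₀ ℕ)) {k : ℕ} :
    HasWeaklyRegularSeq (irrelevant K τ) (MvPolynomial τ K ⧸
      (monomialSpan K (Finsupp.mapDomain f '' S) ⊔ Ideal.span (X '' (Set.range f)ᶜ))) k ↔
    HasWeaklyRegularSeq (irrelevant K σ) (MvPolynomial σ K ⧸ monomialSpan K S) k := by
  set e := quotientEquivOfExtension (K := K) f hf S
  have h₁ (p : MvPolynomial σ K) (x) : e (p • x) = rename f p • e x := by
    obtain ⟨q, rfl⟩ := Ideal.Quotient.mk_surjective x
    change Ideal.Quotient.mk _ (rename f (p * q)) = Ideal.Quotient.mk _ (rename f p * rename f q)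
    rw [map_mul]
  have h₂ (p : MvPolynomial τ K) (x) : e (retraction K f p • x) = p • e x := by
    rw [h₁]
    obtain ⟨q, hq⟩ := Ideal.Quotient.mk_surjective (e x)
    rw [← hq]
    change Ideal.Quotient.mk _ (rename f (retraction K f p) * q) = Ideal.Quotient.mk _ (p * q)
    rw [Ideal.Quotient.eq, ← sub_mul]
    exact Ideal.mul_mem_right _ _ (Ideal.mem_sup_right (rename_retraction_sub_mem f hf _))
  constructor
  · rintro ⟨rs, hl, hm, hrs⟩
    refine ⟨rs.map (retraction K f), by simpa, ?_, ?_⟩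
    · simp only [List.mem_map, forall_exists_index, and_imp, forall_apply_eq_imp_iff₂]
      exact fun r hr => retraction_mem_irrelevant f hf (hm r hr)
    · refine (AddEquiv.isWeaklyRegular_congr (e := (e : _ ≃+ _)) (bs := rs) ?_).2 hrs
      exact List.forall₂_map_left_iff.2 (List.forall₂_same.2 fun r _ => h₂ r)
  · rintro ⟨rs, hl, hm, hrs⟩
    refine ⟨rs.map (rename f), by simpa, ?_, ?_⟩
    · simp only [List.mem_map, forall_exists_index, and_imp, forall_apply_eq_imp_iff₂]
      exact fun r hr => rename_mem_irrelevant f (hm r hr)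
    · refine (AddEquiv.isWeaklyRegular_congr (e := (e : _ ≃+ _)) (as := rs) ?_).1 hrs
      exact List.forall₂_map_right_iff.2 (List.forall₂_same.2 fun r _ => h₁ r)

theorem irrelevant_eq_ker : irrelevant K τ = RingHom.ker (constantCoeff (σ := τ) (R := K)) := by
  ext p
  rw [irrelevant, ← Set.image_univ, mem_ideal_span_X_image, RingHom.mem_ker,
    constantCoeff_eq]
  constructor
  · intro h
    by_contra hp
    obtain ⟨i, -, hi⟩ := h 0 (mem_support_iff.2 hp)
    exact hi rfl
  · intro h m hm
    obtain ⟨i, hi⟩ := Finsupp.ne_iff.1 (show m ≠ 0 by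
      rintro rfl
      exact mem_support_iff.1 hm h)
    exact ⟨i, trivial, hi⟩

/-- Evaluation at the origin factors through the quotient and kills every multiple of the sequence
but not `1`, so properness is automatic. -/
theorem isRegular_iff_isWeaklyRegular {L : Ideal (MvPolynomial τ K)} (hL : L ≤ irrelevant K τ)
    {rs : List (MvPolynomial τ K)} (hrs : ∀ r ∈ rs, r ∈ irrelevant K τ) :
    IsRegular (MvPolynomial τ K ⧸ L) rs ↔ IsWeaklyRegular (MvPolynomial τ K ⧸ L) rs := by
  refine ⟨fun h => h.1, fun h => ⟨h, fun htop => ?_⟩⟩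
  let ψ : MvPolynomial τ K ⧸ L →+* K := Ideal.Quotient.lift L constantCoeff fun a ha => by
    rw [irrelevant_eq_ker] at hL
    exact hL ha
  have hψ : ∀ x ∈ (Ideal.ofList rs • ⊤ : Submodule (MvPolynomial τ K) (MvPolynomial τ K ⧸ L)),
      ψ x = 0 := by
    intro x hx
    induction hx using Submodule.smul_induction_on' with
    | smul r hr n _ =>
      have hr' : r ∈ irrelevant K τ := (Ideal.span_le.2 hrs : Ideal.ofList rs ≤ _) hr
      rw [irrelevant_eq_ker, RingHom.mem_ker] at hr'
      obtain ⟨q, rfl⟩ := Ideal.Quotient.mk_surjective n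
      change constantCoeff (r * q) = 0
      rw [map_mul, hr', zero_mul]
    | add x _ y _ hx hy => rw [map_add, hx, hy, add_zero]
  exact one_ne_zero ((map_one ψ).symm.trans (hψ 1 (htop ▸ trivial)))

theorem depth_eq {L : Ideal (MvPolynomial τ K)} (hL : L ≤ irrelevant K τ) :
    depth K τ (MvPolynomial τ K ⧸ L) = sSup ((fun k : ℕ => (k : ℕ∞)) ''
      {k | HasWeaklyRegularSeq (irrelevant K τ) (MvPolynomial τ K ⧸ L) k}) := by
  rw [depth]
  congr 1
  ext k
  constructor
  · rintro ⟨rs, hl, hm, h⟩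
    exact ⟨rs.length, ⟨rs, rfl, hm, (isRegular_iff_isWeaklyRegular hL hm).1 h⟩, hl⟩
  · rintro ⟨_, ⟨rs, rfl, hm, h⟩, hl⟩
    exact ⟨rs, hl, hm, (isRegular_iff_isWeaklyRegular hL hm).2 h⟩

/-- On the zero module not even the empty sequence is regular, so the supremum is over the empty
set. -/
theorem depth_top : depth K τ (MvPolynomial τ K ⧸ (⊤ : Ideal (MvPolynomial τ K))) = 0 := by
  rw [depth, ← bot_eq_zero, sSup_eq_bot]
  rintro _ ⟨rs, -, -, h⟩
  exact absurd (Subsingleton.elim _ _) h.top_ne_smul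

theorem monomialSpan_le_irrelevant {S : Set (τ →₀ ℕ)} (hS : 0 ∉ S) :
    monomialSpan K S ≤ irrelevant K τ := by
  rw [irrelevant_eq_ker, Ideal.span_le]
  rintro _ ⟨a, ha, rfl⟩
  have : a ≠ 0 := fun h => hS (h ▸ ha)
  classical
  simp [RingHom.mem_ker, constantCoeff_monomial, this]

theorem monomialSpan_eq_top {S : Set (τ →₀ ℕ)} (hS : 0 ∈ S) : monomialSpan K S = ⊤ :=
  (Ideal.eq_top_iff_one _).2 (Ideal.subset_span ⟨0, hS, rfl⟩)

/-- Extending a monomial ideal to a polynomial ring with `c` more variables increases the depth of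
the quotient by `c`. -/
theorem depth_extension [Fintype σ] [Fintype τ] (f : σ → τ) (hf : Function.Injective f)
    (S : Set (σ →₀ ℕ)) {c : ℕ} (hc : Fintype.card τ = Fintype.card σ + c) (h0 : 0 ∈ S → c = 0) :
    depth K τ (MvPolynomial τ K ⧸ monomialSpan K (Finsupp.mapDomain f '' S)) =
      depth K σ (MvPolynomial σ K ⧸ monomialSpan K S) + c := by
  classical
  by_cases hS : 0 ∈ S
  · rw [monomialSpan_eq_top hS, monomialSpan_eq_top (S := Finsupp.mapDomain f '' S)
      ⟨0, hS, Finsupp.mapDomain_zero⟩, depth_top, depth_top, h0 hS]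
    simp
  · have hS' : 0 ∉ Finsupp.mapDomain f '' S := by
      rintro ⟨a, ha, h⟩
      exact hS ((Finsupp.mapDomain_injective hf (h.trans Finsupp.mapDomain_zero.symm)) ▸ ha)
    rw [depth_eq (monomialSpan_le_irrelevant hS), depth_eq (monomialSpan_le_irrelevant hS')]
    set E : Finset τ := (Finset.univ.image f)ᶜ with hE
    have hEc : E.card = c := by
      rw [hE, Finset.card_compl, Finset.card_image_of_injective _ hf, hc, Finset.card_univ]
      simp
    have hE' : (E : Set τ) = (Set.range f)ᶜ := by simp [hE]
    have key (k : ℕ) := (hasWeaklyRegularSeq_union_single (K := K) (k := k)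
      (S := Finsupp.mapDomain f '' S) E (by
        rintro _ ⟨a, -, rfl⟩ y hy
        exact Finsupp.mapDomain_of_notMem_range _ _ (by simpa [hE] using hy))).trans
      (hE' ▸ hasWeaklyRegularSeq_extension_iff f hf S)
    rw [hEc] at key
    apply le_antisymm
    · refine sSup_le ?_
      rintro _ ⟨k, hk, rfl⟩
      rcases le_total c k with h | h
      · obtain ⟨k, rfl⟩ := Nat.exists_eq_add_of_le' h
        push_cast
        gcongr
        exact le_sSup ⟨k, (key k).1 hk, rfl⟩
      · exact (Nat.cast_le.2 h).trans le_add_self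
    -- The empty sequence makes the set nonempty, which is needed to move `c` inside the supremum.
    · rw [ENat.sSup_add (Set.Nonempty.image _ ⟨0, HasWeaklyRegularSeq.zero⟩)]
      refine iSup₂_le ?_
      rintro _ ⟨k, hk, rfl⟩
      exact le_sSup ⟨k + c, (key k).2 hk, by push_cast; rfl⟩

end

/-! ### Stanley partitions of sets of exponent vectors -/

section

variable {τ : Type*}

/-- The exponent vectors of the monomials in `x^a K[Z]`. -/
def block (a : τ →₀ ℕ) (Z : Finset τ) : Set (τ →₀ ℕ) :=
  {p | a ≤ p ∧ ∀ i ∉ Z, p i = a i}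

theorem mem_block_iff {a p : τ →₀ ℕ} {Z : Finset τ} :
    p ∈ block a Z ↔ ∃ b : τ →₀ ℕ, (b.support : Set τ) ⊆ Z ∧ a + b = p := by
  constructor
  · rintro ⟨h, hZ⟩
    refine ⟨p - a, fun i hi => ?_, add_tsub_cancel_of_le h⟩
    by_contra hiZ
    simp only [Finset.mem_coe, Finsupp.mem_support_iff, Finsupp.tsub_apply] at hi
    exact hi (by rw [hZ i hiZ, Nat.sub_self])
  · rintro ⟨b, hb, rfl⟩
    refine ⟨le_self_add, fun i hi => ?_⟩
    have : b i = 0 := by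
      by_contra h
      exact hi (hb (by simpa using h))
    simp [this]

/-- The sets of exponent vectors of `x^{a_i} K[Z_i]` partition `P`. -/
structure IsStanleyPartition {ι : Type*} (P : Set (τ →₀ ℕ)) (a : ι → τ →₀ ℕ)
    (Z : ι → Finset τ) : Prop where
  subset : ∀ i, block (a i) (Z i) ⊆ P
  existsUnique : ∀ p ∈ P, ∃! i, p ∈ block (a i) (Z i)

/-- The Stanley depth of a set of exponent vectors. -/
noncomputable def setSdepth (P : Set (τ →₀ ℕ)) : ℕ∞ :=
  sSup {m | ∃ (r : ℕ) (a : Fin r → τ →₀ ℕ) (Z : Fin r → Finset τ),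
    IsStanleyPartition P a Z ∧ m = ⨅ i, ((Z i).card : ℕ∞)}

theorem IsStanleyPartition.comp_equiv {ι κ : Type*} {P : Set (τ →₀ ℕ)} {a : ι → τ →₀ ℕ}
    {Z : ι → Finset τ} (h : IsStanleyPartition P a Z) (e : κ ≃ ι) :
    IsStanleyPartition P (a ∘ e) (Z ∘ e) :=
  ⟨fun i => h.subset (e i), fun p hp =>
    e.bijective.existsUnique_iff.1 (h.existsUnique p hp)⟩

theorem IsStanleyPartition.le_setSdepth {ι : Type*} [Finite ι] {P : Set (τ →₀ ℕ)}
    {a : ι → τ →₀ ℕ} {Z : ι → Finset τ} (h : IsStanleyPartition P a Z) :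
    ⨅ i, ((Z i).card : ℕ∞) ≤ setSdepth P := by
  obtain ⟨r, ⟨e⟩⟩ := Finite.exists_equiv_fin ι
  exact le_sSup ⟨r, _, _, h.comp_equiv e.symm,
    (e.symm.surjective.iInf_comp fun i => ((Z i).card : ℕ∞)).symm⟩

/-- A set of exponent vectors which depends only on the supports has a Stanley partition. -/
theorem exists_isStanleyPartition [Finite τ] {P : Set (τ →₀ ℕ)}
    (hP : ∀ p q : τ →₀ ℕ, p.support = q.support → (p ∈ P ↔ q ∈ P)) :
    ∃ (r : ℕ) (a : Fin r → τ →₀ ℕ) (Z : Fin r → Finset τ), IsStanleyPartition P a Z := by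
  classical
  -- The squarefree vector with support `F`; its block in the directions `F` consists of all vectors
  -- with support exactly `F`.
  let v (F : Finset τ) : τ →₀ ℕ := Finsupp.equivFunOnFinite.symm fun i => if i ∈ F then 1 else 0
  have hv (F : Finset τ) (i : τ) : v F i = if i ∈ F then 1 else 0 := rfl
  have hvs (F : Finset τ) : (v F).support = F := by ext; simp [hv]
  have hb (F : Finset τ) (p : τ →₀ ℕ) : p ∈ block (v F) F ↔ p.support = F := by
    constructor
    · rintro ⟨h₁, h₂⟩
      ext i
      have h₁ := h₁ i
      have h₂ := h₂ i
      rw [hv] at h₁ h₂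
      by_cases hi : i ∈ F
      · simp only [hi, if_true, Finsupp.mem_support_iff] at h₁ ⊢
        simp only [iff_true]
        omega
      · simp only [hi, if_false, Finsupp.mem_support_iff, not_false_eq_true, true_imp_iff] at h₂ ⊢
        simp [h₂]
    · rintro rfl
      refine ⟨fun i => ?_, fun i hi => ?_⟩
      · rw [hv]
        split_ifs with h
        · exact Nat.one_le_iff_ne_zero.2 (by simpa using h)
        · exact Nat.zero_le _
      · rw [hv, if_neg hi]
        simpa using hi
  have hpart : IsStanleyPartition P (fun F : {F : Finset τ // v F ∈ P} => v F) (fun F => F) := by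
    constructor
    · rintro ⟨F, hF⟩ p hp
      exact (hP p (v F) (((hb F p).1 hp).trans (hvs F).symm)).2 hF
    · intro p hp
      refine ⟨⟨p.support, (hP p _ (hvs _).symm).1 hp⟩, (hb _ p).2 rfl, ?_⟩
      rintro ⟨F, hF⟩ h
      exact Subtype.ext ((hb F p).1 h).symm
  obtain ⟨r, ⟨e⟩⟩ := Finite.exists_equiv_fin {F : Finset τ // v F ∈ P}
  exact ⟨r, _, _, hpart.comp_equiv e.symm⟩

end

section

variable {σ τ : Type*} {f : σ → τ}

theorem mapDomain_le_iff (hf : Function.Injective f) {a : σ →₀ ℕ} {p : τ →₀ ℕ} :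
    a.mapDomain f ≤ p ↔ a ≤ p.comapDomain f hf.injOn := by
  constructor
  · intro h i
    simpa [Finsupp.mapDomain_apply hf] using h (f i)
  · intro h i
    by_cases hi : i ∈ Set.range f
    · obtain ⟨j, rfl⟩ := hi
      simpa [Finsupp.mapDomain_apply hf] using h j
    · simp [Finsupp.mapDomain_of_notMem_range _ _ hi]

theorem comapDomain_mapDomain (hf : Function.Injective f) (a : σ →₀ ℕ) :
    (a.mapDomain f).comapDomain f hf.injOn = a := by
  ext i
  simp [Finsupp.mapDomain_apply hf]

/-- Adding `c` free variables increases the Stanley depth by `c`. -/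
theorem setSdepth_comapDomain [Fintype σ] [Fintype τ] (hf : Function.Injective f) {c : ℕ}
    (hc : Fintype.card τ = Fintype.card σ + c) {P : Set (σ →₀ ℕ)}
    (hP : ∀ p q : σ →₀ ℕ, p.support = q.support → (p ∈ P ↔ q ∈ P)) :
    setSdepth {p : τ →₀ ℕ | p.comapDomain f hf.injOn ∈ P} = setSdepth P + c := by
  classical
  set E : Finset τ := (Finset.univ.image f)ᶜ with hE
  have hEc : E.card = c := by
    rw [hE, Finset.card_compl, Finset.card_image_of_injective _ hf, hc, Finset.card_univ]
    simp
  have hEmem (y : τ) : y ∈ E ↔ y ∉ Set.range f := by simp [hE]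
  apply le_antisymm
  · refine sSup_le ?_
    rintro _ ⟨r, a, Z, h, rfl⟩
    -- Only blocks whose base point vanishes on `E` meet the vectors supported on the image of `f`;
    -- pulled back, they partition `P`.
    have hmem (i : {i : Fin r // ∀ y ∈ E, a i y = 0}) (q : σ →₀ ℕ) :
        q ∈ block ((a i).comapDomain f hf.injOn) ((Z i).preimage f hf.injOn) ↔
          q.mapDomain f ∈ block (a i) (Z i) := by
      constructor
      · rintro ⟨h₁, h₂⟩
        refine ⟨fun y => ?_, fun y hy => ?_⟩
        · by_cases hyE : y ∈ E
          · rw [i.2 y hyE]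
            exact Nat.zero_le _
          · obtain ⟨x, rfl⟩ := not_not.1 (mt (hEmem y).2 hyE)
            simpa [Finsupp.mapDomain_apply hf] using h₁ x
        · by_cases hyE : y ∈ E
          · rw [i.2 y hyE, Finsupp.mapDomain_of_notMem_range _ _ ((hEmem y).1 hyE)]
          · obtain ⟨x, rfl⟩ := not_not.1 (mt (hEmem y).2 hyE)
            simpa [Finsupp.mapDomain_apply hf] using h₂ x (by simpa using hy)
      · rintro ⟨h₁, h₂⟩
        refine ⟨fun x => ?_, fun x hx => ?_⟩
        · simpa [Finsupp.mapDomain_apply hf] using h₁ (f x)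
        · simpa [Finsupp.mapDomain_apply hf] using h₂ (f x) (by simpa using hx)
    have hpart : IsStanleyPartition P
        (fun i : {i : Fin r // ∀ y ∈ E, a i y = 0} => (a i).comapDomain f hf.injOn)
        (fun i => (Z i).preimage f hf.injOn) := by
      constructor
      · intro i q hq
        have := h.subset i ((hmem i q).1 hq)
        rwa [Set.mem_ofPred_eq, comapDomain_mapDomain hf] at this
      · intro q hq
        obtain ⟨i, hi, huniq⟩ := h.existsUnique (q.mapDomain f) (by
          rwa [Set.mem_ofPred_eq, comapDomain_mapDomain hf])
        refine ⟨⟨i, fun y hy => ?_⟩, (hmem _ q).2 hi, ?_⟩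
        · have := hi.1 y
          rw [Finsupp.mapDomain_of_notMem_range _ _ ((hEmem y).1 hy)] at this
          exact Nat.le_zero.1 this
        · intro j hj
          exact Subtype.ext (huniq j ((hmem j q).1 hj))
    refine le_trans ?_ (add_le_add_left hpart.le_setSdepth _)
    rw [ENat.iInf_add]
    refine le_iInf fun i => iInf_le_of_le i.1 ?_
    rw [← hEc]
    norm_cast
    -- Pulling back removes from `Z i` only elements of `E`, so at most `c` of them.
    calc (Z i).card ≤ (((Z i).preimage f hf.injOn).image f ∪ E).card :=
          Finset.card_le_card fun y hy => by
            by_cases hyE : y ∈ E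
            · simp [hyE]
            · obtain ⟨x, rfl⟩ := not_not.1 (mt (hEmem y).2 hyE)
              exact Finset.mem_union_left _ (Finset.mem_image_of_mem _ (by simpa using hy))
      _ ≤ _ := (Finset.card_union_le _ _).trans (add_le_add_left Finset.card_image_le _)
  -- Conversely, all of `E` is added to each `Z i`. Some partition must exist for `c` to move inside
  -- the supremum; this is where dependence on supports alone enters.
  · obtain ⟨r₀, a₀, Z₀, h₀⟩ := exists_isStanleyPartition hP
    rw [setSdepth, ENat.sSup_add]
    swap
    · exact ⟨_, r₀, a₀, Z₀, h₀, rfl⟩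
    refine iSup₂_le ?_
    rintro _ ⟨r, a, Z, h, rfl⟩
    have hmem (i : Fin r) (p : τ →₀ ℕ) :
        p ∈ block ((a i).mapDomain f) ((Z i).image f ∪ E) ↔
          p.comapDomain f hf.injOn ∈ block (a i) (Z i) := by
      rw [block, block, Set.mem_ofPred_eq, Set.mem_ofPred_eq, mapDomain_le_iff hf]
      refine and_congr_right fun _ => ⟨fun h x hx => ?_, fun h y hy => ?_⟩
      · have := h (f x) (by simpa [hf.eq_iff, hE] using hx)
        simpa [Finsupp.mapDomain_apply hf] using this
      · rw [Finset.mem_union, not_or] at hy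
        obtain ⟨x, rfl⟩ := not_not.1 (mt (hEmem y).2 hy.2)
        have := h x fun hx => hy.1 (Finset.mem_image_of_mem _ hx)
        simpa [Finsupp.mapDomain_apply hf] using this
    have hpart : IsStanleyPartition {p : τ →₀ ℕ | p.comapDomain f hf.injOn ∈ P}
        (fun i => (a i).mapDomain f) (fun i => (Z i).image f ∪ E) := by
      constructor
      · intro i p hp
        exact h.subset i ((hmem i p).1 hp)
      · intro p hp
        simpa only [hmem] using h.existsUnique _ hp
    refine le_trans (le_of_eq ?_) hpart.le_setSdepth
    rw [ENat.iInf_add]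
    congr 1
    ext1 i
    rw [Finset.card_union_of_disjoint, Finset.card_image_of_injective _ hf, hEc]
    · push_cast
      rfl
    · rw [Finset.disjoint_left]
      intro y hy hyE
      obtain ⟨x, -, rfl⟩ := Finset.mem_image.1 hy
      exact (hEmem _).1 hyE ⟨x, rfl⟩

end

/-! ### Stanley decompositions as partitions -/

section

variable {K τ M : Type*} [Field K] [AddCommGroup M] [Module K M]

/-- Disjoint subsets of an independent family have independent spans, while a shared basis vector is
a nonzero vector in both spans. -/
theorem isInternal_span_iff {α ι : Type*} [DecidableEq ι] {e : α → M} {P : Set α}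
    (hli : LinearIndepOn K e P) (htop : Submodule.span K (e '' P) = ⊤) {B : ι → Set α}
    (hB : ∀ i, B i ⊆ P) :
    DirectSum.IsInternal (fun i => Submodule.span K (e '' B i)) ↔ ∀ p ∈ P, ∃! i, p ∈ B i := by
  rw [DirectSum.isInternal_submodule_iff_iSupIndep_and_iSup_eq_top]
  have hsup (s : Set ι) : ⨆ i ∈ s, Submodule.span K (e '' B i) =
      Submodule.span K (e '' ⋃ i ∈ s, B i) := by
    simp_rw [Set.image_iUnion, Submodule.span_iUnion]
  have hdisj {A C : Set α} (hA : A ⊆ P) (hC : C ⊆ P) (h : Disjoint A C) :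
      Disjoint (Submodule.span K (e '' A)) (Submodule.span K (e '' C)) :=
    ((linearIndepOn_union_iff h).1 (hli.mono (Set.union_subset hA hC))).2.2
  have hne {p : α} (hp : p ∈ P) : e p ≠ 0 := hli.ne_zero hp
  constructor
  · rintro ⟨hind, hsp⟩ p hp
    have hex : ∃ i, p ∈ B i := by
      by_contra! hc
      have hd := hdisj (A := {p}) (C := ⋃ i, B i) (by simpa using hp) (Set.iUnion_subset hB)
        (by simpa using hc)
      rw [Set.image_iUnion, Submodule.span_iUnion, hsp, disjoint_top] at hd
      simp [hne hp] at hd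
    obtain ⟨i, hi⟩ := hex
    refine ⟨i, hi, fun j hj => ?_⟩
    by_contra hij
    have := (hind.pairwiseDisjoint hij).le_bot
      ⟨Submodule.subset_span ⟨p, hj, rfl⟩, Submodule.subset_span ⟨p, hi, rfl⟩⟩
    exact hne hp (by simpa using this)
  · intro h
    constructor
    · intro i
      have := hsup {j | j ≠ i}
      simp only [Set.mem_ofPred_eq] at this
      rw [this]
      refine hdisj (hB i) (Set.iUnion₂_subset fun j _ => hB j) ?_
      rw [Set.disjoint_left]
      intro p hp hp'
      simp only [Set.mem_iUnion] at hp'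
      obtain ⟨j, hj, hpj⟩ := hp'
      exact hj ((h p (hB i hp)).unique hpj hp)
    · rw [eq_top_iff, ← htop, ← Submodule.span_iUnion, ← Set.image_iUnion]
      refine Submodule.span_mono (Set.image_mono fun p hp => ?_)
      obtain ⟨i, hi, -⟩ := h p hp
      exact Set.mem_iUnion.2 ⟨i, hi⟩

variable [Module (MvPolynomial τ K) M] [IsScalarTower K (MvPolynomial τ K) M]

/-- The elements `e a`, `a ∈ P`, form a `K`-basis of homogeneous elements of `M` on which the
monomials act like on the monomials with exponent vectors in `P`. -/
structure IsMonomialBasis (𝒜 : (τ →₀ ℕ) → Submodule K M) (P : Set (τ →₀ ℕ))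
    (e : (τ →₀ ℕ) → M) : Prop where
  component : ∀ a, 𝒜 a = Submodule.span K {e a}
  eq_zero : ∀ a ∉ P, e a = 0
  monomial_smul : ∀ a ∈ P, ∀ b, (monomial b (1 : K) : MvPolynomial τ K) • e a = e (a + b)
  linearIndepOn : LinearIndepOn K e P
  span_eq_top : Submodule.span K (e '' P) = ⊤

namespace IsMonomialBasis

variable {𝒜 : (τ →₀ ℕ) → Submodule K M} {P : Set (τ →₀ ℕ)} {e : (τ →₀ ℕ) → M}

theorem smul_eq_sum (h : IsMonomialBasis 𝒜 P e) {a : τ →₀ ℕ} (ha : a ∈ P)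
    (p : MvPolynomial τ K) : p • e a = ∑ b ∈ p.support, p.coeff b • e (a + b) := by
  conv_lhs => rw [p.as_sum]
  rw [Finset.sum_smul]
  refine Finset.sum_congr rfl fun b _ => ?_
  rw [← mul_one (coeff b p), ← smul_eq_mul, ← smul_monomial, smul_assoc, h.monomial_smul a ha,
    smul_eq_mul, mul_one]

theorem stanleySpace_eq (h : IsMonomialBasis 𝒜 P e) {a : τ →₀ ℕ} (ha : a ∈ P) (Z : Finset τ)
    {c : K} (hc : c ≠ 0) :
    stanleySpace (K := K) (c • e a) Z = Submodule.span K (e '' block a Z) := by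
  apply le_antisymm
  · rintro _ ⟨p, hp, rfl⟩
    have hp : (p.vars : Set τ) ⊆ Z := mem_supported.1 hp
    change p • c • e a ∈ _
    rw [smul_comm, h.smul_eq_sum ha]
    refine Submodule.smul_mem _ _ (Submodule.sum_mem _ fun b hb => Submodule.smul_mem _ _
      (Submodule.subset_span ⟨a + b, mem_block_iff.2 ⟨b, fun i hi => ?_, rfl⟩, rfl⟩))
    exact hp ((mem_vars_iff_mem_support i).2 ⟨b, hb, hi⟩)
  · rw [Submodule.span_le]
    rintro _ ⟨_, hp, rfl⟩
    obtain ⟨b, hb, rfl⟩ := mem_block_iff.1 hp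
    refine ⟨monomial b c⁻¹, ?_, ?_⟩
    · change monomial b c⁻¹ ∈ supported K (Z : Set τ)
      rwa [mem_supported, vars_monomial (inv_ne_zero hc)]
    · change monomial b c⁻¹ • c • e a = _
      rw [← mul_one c⁻¹, ← smul_eq_mul, ← smul_monomial, smul_assoc, smul_comm _ c,
        inv_smul_smul₀ hc, h.monomial_smul a ha]

theorem eq_zero_of_smul_eq_zero (h : IsMonomialBasis 𝒜 P e) {a : τ →₀ ℕ} (ha : a ∈ P)
    {Z : Finset τ} (hZ : block a Z ⊆ P) {p : MvPolynomial τ K} (hp : p ∈ supported K (Z : Set τ))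
    (h0 : p • e a = 0) : p = 0 := by
  have hp : (p.vars : Set τ) ⊆ Z := mem_supported.1 hp
  rw [h.smul_eq_sum ha] at h0
  have hsub : (p.support.map (addLeftEmbedding a) : Set (τ →₀ ℕ)) ⊆ P := by
    intro q hq
    simp only [Finset.coe_map, Set.mem_image] at hq
    obtain ⟨b, hb, rfl⟩ := hq
    exact hZ (mem_block_iff.2 ⟨b, fun i hi =>
      hp ((mem_vars_iff_mem_support i).2 ⟨b, hb, hi⟩), rfl⟩)
  have := linearIndepOn_finset_iff.1 (h.linearIndepOn.mono hsub) (fun q => p.coeff (q - a))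
    (by simpa using h0)
  ext b
  by_contra hb
  have hb : b ∈ p.support := by simpa using hb
  have := this (a + b) (Finset.mem_map.2 ⟨b, hb, rfl⟩)
  simp only [add_tsub_cancel_left] at this
  exact (mem_support_iff.1 hb) this

/-- Homogeneous generators are nonzero multiples of basis vectors, freeness keeps their blocks
inside `P`, and directness of the sum says that the blocks partition `P`. -/
theorem sdepth_eq (h : IsMonomialBasis 𝒜 P e) : sdepth 𝒜 = setSdepth P := by
  apply le_antisymm
  · refine iSup_le fun D => ?_
    have hD (i : Fin D.r) : ∃ a ∈ P, ∃ c : K, c ≠ 0 ∧ c • e a = D.u i := by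
      obtain ⟨a, ha⟩ := D.homogeneous i
      rw [h.component, Submodule.mem_span_singleton] at ha
      obtain ⟨c, hc⟩ := ha
      have hu : D.u i ≠ 0 := fun h0 => one_ne_zero
        (D.free i 1 (Subalgebra.one_mem _) (by rw [h0, smul_zero]))
      refine ⟨a, ?_, c, ?_, hc⟩
      · by_contra ha
        exact hu (by rw [← hc, h.eq_zero a ha, smul_zero])
      · rintro rfl
        exact hu (by rw [← hc, zero_smul])
    choose a ha c hc hu using hD
    have hsub (i : Fin D.r) : block (a i) (D.Z i) ⊆ P := by
      intro p hp
      by_contra hpP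
      obtain ⟨b, hb, rfl⟩ := mem_block_iff.1 hp
      -- A block vector outside `P` would give a monomial annihilating `u i`.
      have := D.free i (monomial b 1) (by
        rwa [mem_supported, vars_monomial one_ne_zero]) (by
        rw [← hu, smul_comm, h.monomial_smul _ (ha i), h.eq_zero _ hpP, smul_zero])
      simp at this
    have hint := D.isInternal
    simp only [← hu, h.stanleySpace_eq (ha _) _ (hc _)] at hint
    exact (IsStanleyPartition.mk hsub
      ((isInternal_span_iff h.linearIndepOn h.span_eq_top hsub).1 hint)).le_setSdepth
  · refine sSup_le ?_
    rintro _ ⟨r, a, Z, hpart, rfl⟩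
    have ha (i : Fin r) : a i ∈ P := hpart.subset i ⟨le_rfl, fun _ _ => rfl⟩
    exact le_iSup (fun D : StanleyDecomposition 𝒜 => ⨅ i, ((D.Z i).card : ℕ∞))
      { r := r
        u := fun i => e (a i)
        Z := Z
        homogeneous := fun i => ⟨a i, by
          rw [h.component]
          exact Submodule.mem_span_singleton_self _⟩
        free := fun i p hp h0 => h.eq_zero_of_smul_eq_zero (ha i) (hpart.subset i) hp h0
        isInternal := by
          have hs (i : Fin r) := h.stanleySpace_eq (ha i) (Z i) one_ne_zero
          simp only [one_smul] at hs
          simp only [hs]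
          exact (isInternal_span_iff h.linearIndepOn h.span_eq_top hpart.subset).2
            hpart.existsUnique }

end IsMonomialBasis

end

section

variable {K τ : Type*} [Field K] {S : Set (τ →₀ ℕ)}

theorem as_sum_smul (p : MvPolynomial τ K) :
    p = ∑ b ∈ p.support, p.coeff b • monomial b (1 : K) := by
  conv_lhs => rw [p.as_sum]
  simp [smul_monomial]

theorem coeff_sum_smul_monomial (s : Finset (τ →₀ ℕ)) (g : (τ →₀ ℕ) → K) {b : τ →₀ ℕ}
    (hb : b ∈ s) : (∑ a ∈ s, g a • monomial a (1 : K)).coeff b = g b := by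
  classical
  simp [coeff_sum, coeff_monomial, hb]

theorem isMonomialBasis_quotGrading :
    IsMonomialBasis (quotGrading (monomialSpan K S)) {a | monomial a (1 : K) ∉ monomialSpan K S}
      (fun a => Ideal.Quotient.mk (monomialSpan K S) (monomial a 1)) where
  component a := rfl
  eq_zero a ha := Ideal.Quotient.eq_zero_iff_mem.2 (not_not.1 ha)
  monomial_smul a _ b := by
    change Ideal.Quotient.mk _ (monomial b 1 * monomial a 1) = _
    rw [monomial_mul, one_mul, add_comm]
  linearIndepOn := by
    rw [linearIndepOn_iff']
    intro s g hs h0 b hb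
    have : ∑ a ∈ s, g a • monomial a (1 : K) ∈ monomialSpan K S := by
      rw [← Ideal.Quotient.eq_zero_iff_mem, map_sum]
      exact h0
    by_contra hgb
    refine hs hb (mem_monomialSpan_iff.1 this b ?_)
    rwa [mem_support_iff, coeff_sum_smul_monomial s g hb]
  span_eq_top := by
    rw [eq_top_iff]
    rintro x -
    obtain ⟨p, rfl⟩ := Ideal.Quotient.mk_surjective x
    rw [as_sum_smul p, map_sum]
    refine Submodule.sum_mem _ fun b _ => ?_
    change p.coeff b • Ideal.Quotient.mk (monomialSpan K S) (monomial b 1) ∈ _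
    by_cases hb : monomial b (1 : K) ∈ monomialSpan K S
    · rw [Ideal.Quotient.eq_zero_iff_mem.2 hb, smul_zero]
      exact zero_mem _
    · exact Submodule.smul_mem _ _ (Submodule.subset_span ⟨b, hb, rfl⟩)

open Classical in
theorem isMonomialBasis_idealGrading :
    IsMonomialBasis (idealGrading (monomialSpan K S)) {a | monomial a (1 : K) ∈ monomialSpan K S}
      (fun a => if h : monomial a (1 : K) ∈ monomialSpan K S then ⟨monomial a 1, h⟩ else 0) where
  component a := by
    ext ⟨x, hx⟩
    rw [idealGrading, Submodule.mem_comap, Submodule.mem_span_singleton,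
      Submodule.mem_span_singleton]
    change (∃ c : K, c • monomial a (1 : K) = x) ↔ _
    split_ifs with h
    · exact exists_congr fun c => ⟨fun e => Subtype.ext e, fun e => congrArg Subtype.val e⟩
    · simp only [smul_zero, exists_const]
      constructor
      · rintro ⟨c, rfl⟩
        by_cases hc : c = 0
        · ext1
          simp [hc]
        · exact absurd (mem_monomialSpan_iff.1 hx a (by simp [hc])) h
      · intro h0
        exact ⟨0, (zero_smul _ _).trans (congrArg Subtype.val h0)⟩
  eq_zero a ha := dif_neg ha
  monomial_smul a ha b := by
    have ha : monomial a (1 : K) ∈ monomialSpan K S := ha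
    have hm : (monomial b 1 * monomial a 1 : MvPolynomial τ K) = monomial (a + b) 1 := by
      rw [monomial_mul, one_mul, add_comm]
    have hab : monomial (a + b) (1 : K) ∈ monomialSpan K S :=
      hm ▸ Ideal.mul_mem_left _ _ ha
    rw [dif_pos ha, dif_pos hab]
    exact Subtype.ext hm
  linearIndepOn := by
    rw [linearIndepOn_iff']
    intro s g hs h0 b hb
    rw [← coeff_sum_smul_monomial s g hb, ← coeff_zero b]
    congr 1
    have := congrArg Subtype.val h0
    rw [Submodule.coe_sum] at this
    refine (Finset.sum_congr rfl fun a ha => ?_).trans this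
    have ha : monomial a (1 : K) ∈ monomialSpan K S := hs ha
    rw [dif_pos ha]
    rfl
  span_eq_top := by
    rw [eq_top_iff]
    rintro ⟨p, hp⟩ -
    have : (⟨p, hp⟩ : monomialSpan K S) = ∑ b ∈ p.support, p.coeff b •
        (if h : monomial b (1 : K) ∈ monomialSpan K S then ⟨monomial b 1, h⟩ else 0 :
          monomialSpan K S) := by
      ext1
      rw [Submodule.coe_sum]
      refine (as_sum_smul p).trans (Finset.sum_congr rfl fun b hb => ?_)
      rw [dif_pos (mem_monomialSpan_iff.1 hp b hb)]
      rfl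
    rw [this]
    exact Submodule.sum_mem _ fun b hb => Submodule.smul_mem _ _
      (Submodule.subset_span ⟨b, mem_monomialSpan_iff.1 hp b hb, rfl⟩)

end

section

variable {K σ τ : Type*} [Field K] {f : σ → τ} {c : ℕ} {S : Set (σ →₀ ℕ)}

theorem monomial_mem_extension_iff (hf : Function.Injective f) {p : τ →₀ ℕ} :
    monomial p (1 : K) ∈ monomialSpan K (Finsupp.mapDomain f '' S) ↔
      monomial (p.comapDomain f hf.injOn) (1 : K) ∈ monomialSpan K S := by
  simp [monomial_mem_monomialSpan, mapDomain_le_iff hf]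

/-- A squarefree monomial divides `x^p` exactly when its support lies in that of `p`. -/
theorem monomial_mem_iff_of_support_eq (hS : ∀ a ∈ S, ∀ i, a i ≤ 1) {p q : σ →₀ ℕ}
    (h : p.support = q.support) :
    monomial p (1 : K) ∈ monomialSpan K S ↔ monomial q (1 : K) ∈ monomialSpan K S := by
  have key {a p : σ →₀ ℕ} (ha : a ∈ S) : a ≤ p ↔ ∀ i, a i ≠ 0 → i ∈ p.support := by
    refine forall_congr' fun i => ?_
    have := hS a ha i
    rw [Finsupp.mem_support_iff]
    omega
  simp only [monomial_mem_monomialSpan]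
  exact exists_congr fun a => and_congr_right fun ha => by rw [key ha, key ha, h]

/-- Extending a squarefree monomial ideal to a polynomial ring with `c` more variables increases
the Stanley depth of the quotient by `c`. -/
theorem sdepth_quotGrading_extension [Fintype σ] [Fintype τ] (hf : Function.Injective f)
    (hc : Fintype.card τ = Fintype.card σ + c) (hS : ∀ a ∈ S, ∀ i, a i ≤ 1) :
    sdepth (quotGrading (monomialSpan K (Finsupp.mapDomain f '' S))) =
      sdepth (quotGrading (monomialSpan K S)) + c := by
  rw [isMonomialBasis_quotGrading.sdepth_eq, isMonomialBasis_quotGrading.sdepth_eq,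
    ← setSdepth_comapDomain hf hc (P := {a | monomial a (1 : K) ∉ monomialSpan K S})
      fun p q h => not_congr (monomial_mem_iff_of_support_eq hS h)]
  simp only [monomial_mem_extension_iff hf, Set.mem_ofPred_eq]

/-- Extending a squarefree monomial ideal to a polynomial ring with `c` more variables increases
its Stanley depth by `c`. -/
theorem sdepth_idealGrading_extension [Fintype σ] [Fintype τ] (hf : Function.Injective f)
    (hc : Fintype.card τ = Fintype.card σ + c) (hS : ∀ a ∈ S, ∀ i, a i ≤ 1) :
    sdepth (idealGrading (monomialSpan K (Finsupp.mapDomain f '' S))) =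
      sdepth (idealGrading (monomialSpan K S)) + c := by
  rw [isMonomialBasis_idealGrading.sdepth_eq, isMonomialBasis_idealGrading.sdepth_eq,
    ← setSdepth_comapDomain hf hc (P := {a | monomial a (1 : K) ∈ monomialSpan K S})
      fun p q h => monomial_mem_iff_of_support_eq hS h]
  simp only [monomial_mem_extension_iff hf, Set.mem_ofPred_eq]

end

/-! ### Iterates of the squarefree operator -/

/-- The shifted list is still sorted, so the next application sees each factor in the same position
and the shifts add up. -/
theorem sigma_iterate (k : ℕ) (u : ℕ →₀ ℕ) :
    sigma^[k] u = Multiset.toFinsupp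
      (((u.toMultiset.sort (· ≤ ·)).mapIdx fun l i => i + k * l : List ℕ) : Multiset ℕ) := by
  induction k with
  | zero => simp [List.mapIdx_eq_zipIdx_map, List.zipIdx_map_fst]
  | succ k ih =>
    rw [Function.iterate_succ_apply', ih, sigma]
    congr 2
    set L := u.toMultiset.sort (· ≤ ·) with hL
    have hsorted : (L.mapIdx fun l i => i + k * l).Pairwise (· ≤ ·) := by
      rw [List.pairwise_iff_getElem]
      intro i j hi hj hij
      simp only [List.length_mapIdx, List.getElem_mapIdx] at hi hj ⊢
      have := List.pairwise_iff_getElem.1 (Multiset.pairwise_sort u.toMultiset (· ≤ ·)) i j hi hj hij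
      gcongr
    rw [show Multiset.sort (Finsupp.toMultiset (Multiset.toFinsupp
        (↑(L.mapIdx fun l i => i + k * l) : Multiset ℕ))) (· ≤ ·) =
        L.mapIdx fun l i => i + k * l by
      rw [Multiset.toFinsupp_toMultiset, Multiset.coe_sort]
      exact List.mergeSort_of_pairwise (by simpa using hsorted)]
    rw [List.mapIdx_mapIdx]
    congr 1
    funext l i
    simp
    ring

/-- Used with reduction modulo `k` and `k' = 0`, to recover `u`, and with the block shift, to pass
from `σ^n` to `σ^t`. -/
theorem mapDomain_sigma_iterate {n k k' : ℕ} {h : ℕ → ℕ}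
    (hh : ∀ l i, i < n → h (i + k * l) = i + k' * l) {u : ℕ →₀ ℕ} (hu : ∀ i ∈ u.support, i < n) :
    (sigma^[k] u).mapDomain h = sigma^[k'] u := by
  apply Multiset.toFinsupp.symm.injective
  change Finsupp.toMultiset _ = Finsupp.toMultiset _
  rw [← Finsupp.toMultiset_map, sigma_iterate, sigma_iterate, Multiset.toFinsupp_toMultiset,
    Multiset.toFinsupp_toMultiset, Multiset.map_coe]
  congr 1
  apply List.ext_getElem
  · simp
  · intro l hl _
    simp only [List.getElem_map, List.getElem_mapIdx]
    refine hh _ _ (hu _ ?_)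
    rw [← Finsupp.mem_toMultiset, ← Multiset.mem_sort (r := (· ≤ ·))]
    exact List.getElem_mem _

theorem sigma_iterate_support_lt {n d k : ℕ} (hk : n ≤ k) {u : ℕ →₀ ℕ}
    (hu : ∀ i ∈ u.support, i < n) (hd : u.degree ≤ d) {j : ℕ} (hj : j ∈ (sigma^[k] u).support) :
    j < k * d := by
  rw [sigma_iterate, Multiset.toFinsupp_support, Multiset.mem_toFinset, Multiset.mem_coe,
    List.mem_mapIdx] at hj
  obtain ⟨l, hl, rfl⟩ := hj
  have hi : (u.toMultiset.sort (· ≤ ·))[l] < n := by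
    refine hu _ ?_
    rw [← Finsupp.mem_toMultiset, ← Multiset.mem_sort (r := (· ≤ ·))]
    exact List.getElem_mem _
  rw [Multiset.length_sort, Finsupp.card_toMultiset] at hl
  have hl : l < d := hl.trans_le hd
  calc _ < k + k * l := by gcongr; exact hi.trans_le hk
    _ = k * (l + 1) := by ring
    _ ≤ k * d := by gcongr; exact hl

theorem sigma_iterate_le_one {k : ℕ} (hk : 1 ≤ k) (u : ℕ →₀ ℕ) (j : ℕ) :
    (sigma^[k] u) j ≤ 1 := by
  rw [sigma_iterate, Multiset.toFinsupp_apply]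
  refine Multiset.nodup_iff_count_le_one.1 (Multiset.coe_nodup.2 ?_) j
  refine List.Pairwise.imp (R := (· < ·)) (fun h => h.ne) ?_
  rw [List.pairwise_iff_getElem]
  intro i j hi hj hij
  simp only [List.length_mapIdx, List.getElem_mapIdx] at hi hj ⊢
  have := List.pairwise_iff_getElem.1 (Multiset.pairwise_sort u.toMultiset (· ≤ ·)) i j hi hj hij
  have : k * i < k * j := by gcongr
  omega

section

variable {n : ℕ}

/-- The exponent vector of `σ^k(u)`, for a monomial `u` of `T_n`. -/
noncomputable def sigmaPow (k : ℕ) (u : Fin n →₀ ℕ) : ℕ →₀ ℕ :=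
  sigma^[k] (u.mapDomain Fin.val)

theorem mapDomain_val_support_lt (u : Fin n →₀ ℕ) {i : ℕ}
    (hi : i ∈ (u.mapDomain Fin.val).support) : i < n := by
  classical
  obtain ⟨j, -, rfl⟩ := Finset.mem_image.1 (Finsupp.mapDomain_support hi)
  exact j.2

/-- Reduction of indices modulo `k` undoes `σ^k`, since the original indices are below `n ≤ k`, and
it preserves divisibility. -/
theorem le_of_sigmaPow_le {k : ℕ} (hk : n ≤ k) {u v : Fin n →₀ ℕ}
    (h : sigmaPow k u ≤ sigmaPow k v) : u ≤ v := by
  have key (u : Fin n →₀ ℕ) : (sigmaPow k u).mapDomain (· % k) = u.mapDomain Fin.val :=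
    mapDomain_sigma_iterate (k' := 0) (fun l i hi => by
      simp [Nat.mod_eq_of_lt (hi.trans_le hk)]) fun i hi => mapDomain_val_support_lt u hi
  have := Finsupp.mapDomain_mono (f := (· % k)) h
  rwa [key, key, mapDomain_le_iff Fin.val_injective, comapDomain_mapDomain Fin.val_injective] at this

end

/-! ### Minimal generators under iteration -/

section

variable {K τ : Type*} [Field K]

theorem minGens_monomialSpan_subset (A : Set (τ →₀ ℕ)) : minGens (monomialSpan K A) ⊆ A := by
  intro a ha
  obtain ⟨b, hb, hba⟩ := monomial_mem_monomialSpan.1 ha.1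
  exact (hba.antisymm (ha.2 (monomial_mem_monomialSpan.2 ⟨b, hb, le_rfl⟩) hba)) ▸ hb

theorem minGens_monomialSpan {A : Set (τ →₀ ℕ)} (hA : ∀ a ∈ A, ∀ b ∈ A, a ≤ b → a = b) :
    minGens (monomialSpan K A) = A := by
  refine (minGens_monomialSpan_subset A).antisymm fun a ha =>
    ⟨monomial_mem_monomialSpan.2 ⟨a, ha, le_rfl⟩, fun b hb hba => ?_⟩
  obtain ⟨c, hc, hcb⟩ := monomial_mem_monomialSpan.1 hb
  exact hA c hc a ha (hcb.trans hba) ▸ hcb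

theorem minGens_antichain {I : Ideal (MvPolynomial τ K)} {a b : τ →₀ ℕ} (ha : a ∈ minGens I)
    (hb : b ∈ minGens I) (h : a ≤ b) : a = b :=
  h.antisymm (hb.2 ha.1 h)

theorem minGens_finite [Finite τ] (I : Ideal (MvPolynomial τ K)) : (minGens I).Finite :=
  WellQuasiOrderedLE.finite_of_isAntichain fun _ ha _ hb hne h =>
    hne (minGens_antichain ha hb h)

theorem degree_le_idealDegree [Finite τ] {I : Ideal (MvPolynomial τ K)} {a : τ →₀ ℕ}
    (ha : a ∈ minGens I) : a.degree ≤ idealDegree I :=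
  le_csSup ((minGens_finite I).image _).bddAbove ⟨a, ha, rfl⟩

theorem idealDegree_eq_zero {I : Ideal (MvPolynomial τ K)} (h : 0 ∈ minGens I) :
    idealDegree I = 0 := by
  have : minGens I = {0} :=
    Set.eq_singleton_iff_unique_mem.2 ⟨h, fun a ha => (minGens_antichain h ha zero_le).symm⟩
  simp [idealDegree, this]

theorem IsMonomialIdeal.eq_monomialSpan [Finite τ] {I : Ideal (MvPolynomial τ K)}
    (hI : IsMonomialIdeal I) : I = monomialSpan K (minGens I) := by
  apply le_antisymm
  · obtain ⟨S, hS⟩ := hI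
    conv_lhs => rw [hS]
    rw [Ideal.span_le]
    rintro _ ⟨a, ha, rfl⟩
    obtain ⟨b, hba, hb⟩ := exists_minimal_le_of_wellFoundedLT
      (fun b => monomial b (1 : K) ∈ I) a (by
        rw [hS]
        exact Ideal.subset_span ⟨a, ha, rfl⟩)
    exact monomial_mem_monomialSpan.2 ⟨b, hb, hba⟩
  · rw [Ideal.span_le]
    rintro _ ⟨a, ha, rfl⟩
    exact ha.1

variable {n : ℕ} {I : Ideal (MvPolynomial (Fin n) K)}

theorem sqIdeal_eq {k : ℕ} {J : Ideal (MvPolynomial ℕ K)} {U : Set (Fin n →₀ ℕ)}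
    (h : minGens J = sigmaPow k '' U) : sqIdeal J = monomialSpan K (sigmaPow (k + 1) '' U) := by
  rw [sqIdeal, h, Set.image_image, monomialSpan, Set.image_image]
  simp only [sigmaPow, Function.iterate_succ_apply']

/-- A subset `U` is needed because early steps can lose generators: `x_2` and `x_1^2` are
incomparable, but their images are `x_2` and `x_1 x_2`. -/
theorem exists_iterSqIdeal_eq (hI : IsMonomialIdeal I) (k : ℕ) :
    ∃ U ⊆ minGens I, iterSqIdeal I k = monomialSpan K (sigmaPow k '' U) := by
  induction k with
  | zero =>
    refine ⟨minGens I, subset_rfl, ?_⟩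
    change I.map _ = _
    conv_lhs => rw [hI.eq_monomialSpan, monomialSpan, Ideal.map_span, Set.image_image]
    rw [monomialSpan, Set.image_image]
    simp only [sigmaPow, rename_monomial, Function.iterate_zero, id]
  | succ k ih =>
    obtain ⟨U, hU, h⟩ := ih
    obtain ⟨V, hV, hVU⟩ := Set.subset_image_iff.1
      (minGens_monomialSpan_subset (K := K) (sigmaPow k '' U))
    refine ⟨V, hV.trans hU, ?_⟩
    rw [iterSqIdeal, Function.iterate_succ_apply', ← iterSqIdeal, h, sqIdeal_eq hVU.symm]

/-- From the `n`-th step on, the squarefree operator keeps all generators. -/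
theorem exists_iterSqIdeal_eq_of_le (hI : IsMonomialIdeal I) :
    ∃ U ⊆ minGens I, ∀ k, n ≤ k → iterSqIdeal I k = monomialSpan K (sigmaPow k '' U) := by
  obtain ⟨U, hU, h⟩ := exists_iterSqIdeal_eq hI n
  refine ⟨U, hU, fun k hk => ?_⟩
  induction k, hk using Nat.le_induction with
  | base => exact h
  | succ k hk ih =>
    rw [iterSqIdeal, Function.iterate_succ_apply', ← iterSqIdeal, ih]
    refine sqIdeal_eq (minGens_monomialSpan ?_)
    rintro _ ⟨u, hu, rfl⟩ _ ⟨v, hv, rfl⟩ hle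
    rw [minGens_antichain (hU hu) (hU hv) (le_of_sigmaPow_le hk hle)]

end

/-! ### The embedding of variables and the main theorem -/

/-- The embedding of the variables of `T_{nd}` into those of `T_{td}`. -/
def blockEmbedding (n t d : ℕ) (hnt : n ≤ t) (j : Fin (n * d)) : Fin (t * d) :=
  ⟨j / n * (t - n) + j, by
    have hj : (j : ℕ) / n < d := Nat.div_lt_of_lt_mul j.2
    have hn : 0 < n := Nat.pos_of_mul_pos_right (j.1.zero_le.trans_lt j.2)
    obtain ⟨s, rfl⟩ := Nat.exists_eq_add_of_le hnt
    have h₁ := Nat.div_add_mod (j : ℕ) n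
    have h₂ := Nat.mod_lt (j : ℕ) hn
    rw [Nat.add_sub_cancel_left]
    calc (j : ℕ) / n * s + j < (n + s) * ((j : ℕ) / n + 1) := by nlinarith
      _ ≤ (n + s) * d := by gcongr; exact hj⟩

/-- Writing `j = bn + r` shows that the block number `b` and the offset `r` are kept while the block
length grows to `t`. -/
theorem blockEmbedding_val_eq {n : ℕ} (t d : ℕ) (hnt : n ≤ t) (j : Fin (n * d)) :
    (blockEmbedding n t d hnt j : ℕ) = (j : ℕ) / n * t + (j : ℕ) % n := by
  obtain ⟨s, rfl⟩ := Nat.exists_eq_add_of_le hnt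
  have := Nat.div_add_mod (j : ℕ) n
  change (j : ℕ) / n * (n + s - n) + j = _
  rw [Nat.add_sub_cancel_left]
  linarith [mul_comm n ((j : ℕ) / n), mul_add ((j : ℕ) / n) n s]

theorem blockEmbedding_injective {n : ℕ} (t d : ℕ) (hnt : n ≤ t) :
    Function.Injective (blockEmbedding n t d hnt) := by
  refine StrictMono.injective fun i j hij => ?_
  change (i : ℕ) / n * (t - n) + i < (j : ℕ) / n * (t - n) + j
  have : (i : ℕ) / n ≤ (j : ℕ) / n := Nat.div_le_div_right hij.le
  have : (i : ℕ) / n * (t - n) ≤ (j : ℕ) / n * (t - n) := Nat.mul_le_mul_right _ this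
  have : (i : ℕ) < j := hij
  omega

theorem mem_range_blockEmbedding {n t d : ℕ} (hn : 1 ≤ n) (hnt : n ≤ t) (k : Fin (t * d)) :
    k ∈ Set.range (blockEmbedding n t d hnt) ↔ (k : ℕ) % t < n := by
  constructor
  · rintro ⟨j, rfl⟩
    have := Nat.mod_lt (j : ℕ) hn
    rwa [blockEmbedding_val_eq, mul_comm, Nat.mul_add_mod, Nat.mod_eq_of_lt (this.trans_le hnt)]
  · intro h
    have hd : (k : ℕ) / t < d := Nat.div_lt_of_lt_mul k.2
    refine ⟨⟨(k : ℕ) / t * n + (k : ℕ) % t, ?_⟩, Fin.ext ?_⟩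
    · calc _ < n * ((k : ℕ) / t + 1) := by linarith [mul_comm n ((k : ℕ) / t)]
        _ ≤ n * d := by gcongr; exact hd
    · rw [blockEmbedding_val_eq]
      dsimp only
      rw [mul_comm _ n, Nat.mul_add_div hn, Nat.div_eq_of_lt h, Nat.mul_add_mod,
        Nat.mod_eq_of_lt h, add_zero, mul_comm, Nat.div_add_mod]

theorem extraVars_eq (K : Type*) [Field K] {n t d : ℕ} (hn : 1 ≤ n) (hnt : n ≤ t) :
    extraVars K n t d = Ideal.span (X '' (Set.range (blockEmbedding n t d hnt))ᶜ) := by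
  rw [extraVars]
  congr 1
  ext p
  simp [mem_range_blockEmbedding hn, eq_comm]

/-- The exponent vectors of the generators `σ^n(u)`, `u ∈ U`, generate both ideals. -/
theorem exists_generators {K : Type*} [Field K] {n t d : ℕ} (hn : 1 ≤ n) (hnt : n ≤ t)
    {I : Ideal (MvPolynomial (Fin n) K)} (hd : d = idealDegree I) {U : Set (Fin n →₀ ℕ)}
    (hU : U ⊆ minGens I) :
    ∃ S : Set (Fin (n * d) →₀ ℕ), (∀ a ∈ S, ∀ i, a i ≤ 1) ∧ (0 ∈ S → d = 0) ∧
      inT (n * d) (monomialSpan K (sigmaPow n '' U)) = monomialSpan K S ∧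
      inT (t * d) (monomialSpan K (sigmaPow t '' U)) =
        monomialSpan K (Finsupp.mapDomain (blockEmbedding n t d hnt) '' S) := by
  have hval (u : Fin n →₀ ℕ) (hu : u ∈ U) : ((sigmaPow n u).comapDomain
      (Fin.val : Fin (n * d) → ℕ) Fin.val_injective.injOn).mapDomain Fin.val = sigmaPow n u := by
    refine Finsupp.mapDomain_comapDomain _ Fin.val_injective _ fun j hj => ?_
    -- The degree bound `deg u ≤ d` places every variable of `σ^n(u)` among the first `nd`.
    refine ⟨⟨j, sigma_iterate_support_lt le_rfl (fun i hi => mapDomain_val_support_lt u hi) ?_ hj⟩,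
      rfl⟩
    rw [Finsupp.degree_mapDomain, hd]
    exact degree_le_idealDegree (hU hu)
  have hshift (u : Fin n →₀ ℕ) :
      (sigmaPow n u).mapDomain (fun j => j / n * (t - n) + j) = sigmaPow t u := by
    refine mapDomain_sigma_iterate (fun l i hi => ?_) fun i hi => mapDomain_val_support_lt u hi
    obtain ⟨s, rfl⟩ := Nat.exists_eq_add_of_le hnt
    rw [Nat.add_mul_div_left _ _ hn, Nat.div_eq_of_lt hi, Nat.add_sub_cancel_left]
    ring
  have hcomp (a : Fin (n * d) →₀ ℕ) :
      (a.mapDomain (blockEmbedding n t d hnt)).mapDomain Fin.val =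
        (a.mapDomain Fin.val).mapDomain (fun j => j / n * (t - n) + j) := by
    rw [← Finsupp.mapDomain_comp, ← Finsupp.mapDomain_comp]
    rfl
  set S : Set (Fin (n * d) →₀ ℕ) :=
    (fun u => (sigmaPow n u).comapDomain Fin.val Fin.val_injective.injOn) '' U with hS
  have hSn : sigmaPow n '' U = Finsupp.mapDomain Fin.val '' S := by
    rw [hS, Set.image_image]
    exact Set.image_congr fun u hu => (hval u hu).symm
  have hSt : sigmaPow t '' U =
      Finsupp.mapDomain Fin.val '' (Finsupp.mapDomain (blockEmbedding n t d hnt) '' S) := by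
    rw [hS, Set.image_image, Set.image_image]
    exact Set.image_congr fun u hu => by rw [hcomp, hval u hu, hshift]
  refine ⟨S, ?_, ?_, ?_, ?_⟩
  · rintro _ ⟨u, hu, rfl⟩ i
    exact sigma_iterate_le_one hn _ _
  · rintro ⟨u, hu, h0⟩
    have h := hval u hu
    dsimp only at h0
    rw [h0, Finsupp.mapDomain_zero] at h
    -- `σ^n(u) = 1` divides `σ^n(1)`, so `u` divides `1`.
    have hu0 : u = 0 := le_bot_iff.1 (le_of_sigmaPow_le le_rfl (v := 0) (by rw [← h]; exact zero_le))
    rw [hd]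
    exact idealDegree_eq_zero (hu0 ▸ hU hu)
  · rw [inT, hSn, comap_rename_monomialSpan _ Fin.val_injective]
  · rw [inT, hSt, comap_rename_monomialSpan _ Fin.val_injective]

end SqOp

theorem corollary1p5 {K : Type*} [Field K] (n t d : ℕ) (hn : 1 ≤ n) (hnt : n ≤ t)
    (I : Ideal (MvPolynomial (Fin n) K)) (hI : SqOp.IsMonomialIdeal I) (hI0 : I ≠ ⊥)
    (hd : d = SqOp.idealDegree I)
    -- `J k` is `I^{σ^k}`, defined recursively or as the ideal generated by `σ^k(u)`, `u ∈ G(I)`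
    (J : ℕ → Ideal (MvPolynomial ℕ K))
    (hJ : J = SqOp.iterSqIdeal I ∨ J = SqOp.genSqIdeal I) :
    (∃ e : (MvPolynomial (Fin (n * d)) K ⧸ SqOp.inT (n * d) (J n)) ≃ₐ[K]
        (MvPolynomial (Fin (t * d)) K ⧸ (SqOp.inT (t * d) (J t) ⊔ SqOp.extraVars K n t d)),
      ∀ (j : Fin (n * d)) (k : Fin (t * d)), (k : ℕ) = (j : ℕ) / n * (t - n) + j →
        e (Ideal.Quotient.mk _ (MvPolynomial.X j)) =
          Ideal.Quotient.mk _ (MvPolynomial.X k)) ∧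
    SqOp.depth K (Fin (t * d)) (MvPolynomial (Fin (t * d)) K ⧸ SqOp.inT (t * d) (J t)) =
      SqOp.depth K (Fin (n * d)) (MvPolynomial (Fin (n * d)) K ⧸ SqOp.inT (n * d) (J n)) +
        (((t - n) * d : ℕ) : ℕ∞) ∧
    SqOp.sdepth (SqOp.quotGrading (SqOp.inT (t * d) (J t))) =
      SqOp.sdepth (SqOp.quotGrading (SqOp.inT (n * d) (J n))) + (((t - n) * d : ℕ) : ℕ∞) ∧
    SqOp.sdepth (SqOp.idealGrading (SqOp.inT (t * d) (J t))) =
      SqOp.sdepth (SqOp.idealGrading (SqOp.inT (n * d) (J n))) + (((t - n) * d : ℕ) : ℕ∞) := by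
  -- Both versions of `J` take this form; what matters is that the same `U` serves `k = n` and `k =
  -- t`.
  obtain ⟨U, hU, hJU⟩ : ∃ U ⊆ SqOp.minGens I, ∀ k, n ≤ k →
      J k = SqOp.monomialSpan K (SqOp.sigmaPow k '' U) := by
    rcases hJ with rfl | rfl
    · exact SqOp.exists_iterSqIdeal_eq_of_le hI
    · refine ⟨SqOp.minGens I, subset_rfl, fun k _ => ?_⟩
      rw [SqOp.monomialSpan, Set.image_image]
      rfl
  obtain ⟨S, hS, hS0, hSn, hSt⟩ := SqOp.exists_generators (K := K) hn hnt hd hU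
  have hinj := SqOp.blockEmbedding_injective t d hnt
  have hcard : Fintype.card (Fin (t * d)) = Fintype.card (Fin (n * d)) + (t - n) * d := by
    rw [Fintype.card_fin, Fintype.card_fin, ← add_mul, Nat.add_sub_cancel' hnt]
  rw [hJU n le_rfl, hJU t hnt, hSn, hSt, SqOp.extraVars_eq K hn hnt]
  refine ⟨⟨SqOp.quotientEquivOfExtension _ hinj S, fun j k hk => ?_⟩, ?_, ?_, ?_⟩
  · rw [SqOp.quotientEquivOfExtension_mk, MvPolynomial.rename_X]
    congr 2
    exact Fin.ext hk.symm
  -- In the unit ideal case `d = 0`, so no variable is added and both depths are `0`.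
  · exact SqOp.depth_extension _ hinj S hcard fun h => by rw [hS0 h, mul_zero]
  · exact SqOp.sdepth_quotGrading_extension hinj hcard hS
  · exact SqOp.sdepth_idealGrading_extension hinj hcard hS
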